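/- Let $G$ be a group and $M$ an abelian $G$-module. Let $C^n(G,M)$ be the group of maps $G^{n}\to M$, with differential $\partial\colon C^n(G,M)\to C^{n+1}(G,M)$, $$(c\partial)(g_n,\dots,g_0)=c(g_n,\dots,g_1)+\sum_{k=1}^{n}(-1)^k c(g_n,\dots,g_kg_{k-1},\dots,g_0)+(-1)^{n+1}g_n\,c(g_{n-1},\dots,g_0),$$ cocycle groups $Z^n(G,M)$ and coboundary groups $B^n(G,M)$. A cochain $c$ is componentwise pointed if $c(g_{n-1},\dots,g_0)=0$ whenever some $g_i=1$. Let $Z^n_{\mathrm{cpt}}(G,M)$ and $B^n_{\mathrm{cpt}}(G,M)$ be the groups of componentwise pointed cocycles and coboundaries, and $H^n_{\mathrm{cpt}}(G,M)=Z^n_{\mathrm{cpt}}(G,M)/B^n_{\mathrm{cpt}}(G,M)$. A crossed module consists of groups $E_0$ and $E_1$, an action of $E_0$ on $E_1$ by automorphisms and a homomorphism $\mu\colon E_1\to E_0$ with $\mu({}^{g}m)=g\,\mu(m)\,g^{-1}$ and ${}^{\mu(n)}m=nmn^{-1}$. A crossed module extension $E$ of $G$ with $M$ is a crossed module $\mu\colon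 E_1\to E_0$ together with an injective homomorphism $\iota\colon M\to E_1$ and a surjective homomorphism $\pi\colon E_0\to G$ such that $M\xrightarrow{\iota}E_1\xrightarrow{\mu}E_0\xrightarrow{\pi}G$ is exact and ${}^{e}\iota(m)=\iota(\pi(e)m)$ for all $e\in E_0$, $m\in M$. An extension equivalence $E\to\tilde E$ is a morphism of crossed modules (a pair of homomorphisms $E_0\to\tilde E_0$, $E_1\to\tilde E_1$ compatible with the structure morphisms and the actions) that is compatible with $\iota,\tilde\iota$ and $\pi,\tilde\pi$. For a Grothendieck universe $\mathfrak U$ containing an infinite set and with $G$ and $M$ in $\mathfrak U$, let $\approx$ be the equivalence relation on the crossed module extensions of $G$ with $M$ in $\mathfrak U$ generated by the existence of an extension equivalence, and let $\mathrm{Ext}^2_{\mathfrak U}(G,M)$ be the set of its classes. Extensions $E,\tilde E$ with $E\approx\tilde E$ are called extension equivalent. For $z\in Z^3_{\mathrm{cpt}}(G,M)$ the standard extension $\mathrm{StdExt}(z)$ is the following crossed module extension. Its group part is the free group $F$ on the pointed set $(G,1)$, with basis $s\colon G\to F$ (so $s(1)=1$ and $F$ is free on the elements $s(g)$ with $g\ne1$),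 and $\pi\colon F\to G$ is the homomorphism with $\pi(s(g))=g$. Its module part is $M\times\ker\pi$, with $\mu(m,r)=r$ and $\iota(m)=(m,1)$. With $[h,g]:=s(h)s(g)s(hg)^{-1}\in\ker\pi$, the action of $F$ on $M\times\ker\pi$ is the unique one with $${}^{s(k)}(m,1)=(km,1),\qquad {}^{s(k)}(0,[h,g])=\bigl(-z(k,h,g),\,s(k)[h,g]s(k)^{-1}\bigr)\qquad(m\in M,\ g,h,k\in G).$$ If $z,\tilde z\in Z^3_{\mathrm{cpt}}(G,M)$ satisfy $z+B^3_{\mathrm{cpt}}(G,M)=\tilde z+B^3_{\mathrm{cpt}}(G,M)$, then $\mathrm{StdExt}(z)\approx\mathrm{StdExt}(\tilde z)$. Hence there is a unique map $$H^3_{\mathrm{cpt}}(G,M)\to\mathrm{Ext}^2_{\mathfrak U}(G,M)$$ that sends $z+B^3_{\mathrm{cpt}}(G,M)$ to the class of $\mathrm{StdExt}(z)$ for every $z\in Z^3_{\mathrm{cpt}}(G,M)$. -/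

import Mathlib

universe u

/-! ### Cohomology of groups via componentwise pointed cochains -/

section Cohomology

variable (G : Type*) (M : Type*) [Group G] [AddCommGroup M] [DistribMulAction G M]

/-- The group of `n`-cochains of `G` with coefficients in `M`. An `n`-tuple
`(g_{n-1}, …, g_0)` is read from left to right, so it is `![g_{n-1}, …, g_0]`. -/
abbrev GroupCochain (n : ℕ) : Type _ := (Fin n → G) → M

/-- The differential of the cochain complex:
`(g_n, …, g_0) ↦ c (g_n, …, g_1) + ∑_{k=1}^{n} (-1)^k c (g_n, …, g_k g_{k-1}, …, g_0)
  + (-1)^{n+1} g_n c (g_{n-1}, …, g_0)`.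
The summand for `k` is the one with `j = n - k` below; `Fin.contractNth j` multiplies the
entries at the places `j` and `j + 1`, and drops the last entry if `j = n`. -/
def cochainDifferential (n : ℕ) : GroupCochain G M n →+ GroupCochain G M (n + 1) where
  toFun c g := (∑ j : Fin (n + 1), (-1 : ℤ) ^ (n - (j : ℕ)) • c (Fin.contractNth j (· * ·) g))
    + (-1 : ℤ) ^ (n + 1) • (g 0 • c (fun i => g i.succ))
  map_zero' := by
    funext g
    simp
  map_add' c d := by
    funext g
    simp only [Pi.add_apply, smul_add, Finset.sum_add_distrib]
    abel

/-- The group of `n`-cocycles. -/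
def groupCocycles (n : ℕ) : AddSubgroup (GroupCochain G M n) := (cochainDifferential G M n).ker

/-- The group of `n`-coboundaries. -/
def groupCoboundaries : (n : ℕ) → AddSubgroup (GroupCochain G M n)
  | 0 => ⊥
  | n + 1 => (cochainDifferential G M n).range

/-- The group of componentwise pointed `n`-cochains. -/
def cptCochains (n : ℕ) : AddSubgroup (GroupCochain G M n) where
  carrier := {c | ∀ g : Fin n → G, (∃ i, g i = 1) → c g = 0}
  zero_mem' := fun _ _ => rfl
  add_mem' := fun {c d} hc hd g hg => by simp [hc g hg, hd g hg]
  neg_mem' := fun {c} hc g hg => by simp [hc g hg]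

/-- The group of componentwise pointed `n`-cocycles. -/
def cptCocycles (n : ℕ) : AddSubgroup (GroupCochain G M n) :=
  cptCochains G M n ⊓ groupCocycles G M n

/-- The group of componentwise pointed `n`-coboundaries. -/
def cptCoboundaries (n : ℕ) : AddSubgroup (GroupCochain G M n) :=
  cptCochains G M n ⊓ groupCoboundaries G M n

/-- The group of componentwise pointed `n`-cohomology classes: the quotient of the componentwise
pointed `n`-cocycles by the componentwise pointed `n`-coboundaries. -/
abbrev CptCohomology (n : ℕ) : Type _ :=
  cptCocycles G M n ⧸ (cptCoboundaries G M n).addSubgroupOf (cptCocycles G M n)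

end Cohomology

section Cocycle

variable {G : Type*} {M : Type*} [Group G] [AddCommGroup M] [DistribMulAction G M]

/-- The cohomology class of a componentwise pointed cocycle. -/
def cptClass {n : ℕ} (z : cptCocycles G M n) : CptCohomology G M n := QuotientAddGroup.mk z

theorem cochainDifferential_two (c : GroupCochain G M 2) (k h g : G) :
    cochainDifferential G M 2 c ![k, h, g]
      = c ![k, h] - c ![k, h * g] + c ![k * h, g] - k • c ![h, g] := by
  have e0 : Fin.contractNth 0 (· * ·) ![k, h, g] = ![k * h, g] := by
    funext i; fin_cases i <;> rfl
  have e1 : Fin.contractNth 1 (· * ·) ![k, h, g] = ![k, h * g] := by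
    funext i; fin_cases i <;> rfl
  have e2 : Fin.contractNth 2 (· * ·) ![k, h, g] = ![k, h] := by
    funext i; fin_cases i <;> rfl
  have e3 : (fun i : Fin 2 => ![k, h, g] i.succ) = ![h, g] := by
    funext i; fin_cases i <;> rfl
  change (∑ j : Fin 3, (-1 : ℤ) ^ (2 - (j : ℕ)) • c (Fin.contractNth j (· * ·) ![k, h, g]))
    + (-1 : ℤ) ^ 3 • (k • c (fun i : Fin 2 => ![k, h, g] i.succ)) = _
  rw [Fin.sum_univ_three, e0, e1, e2, e3]
  simp
  abel

theorem cochainDifferential_three (c : GroupCochain G M 3) (l k h g : G) :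
    cochainDifferential G M 3 c ![l, k, h, g]
      = c ![l, k, h] - c ![l, k, h * g] + c ![l, k * h, g] - c ![l * k, h, g]
        + l • c ![k, h, g] := by
  have e0 : Fin.contractNth 0 (· * ·) ![l, k, h, g] = ![l * k, h, g] := by
    funext i; fin_cases i <;> rfl
  have e1 : Fin.contractNth 1 (· * ·) ![l, k, h, g] = ![l, k * h, g] := by
    funext i; fin_cases i <;> rfl
  have e2 : Fin.contractNth 2 (· * ·) ![l, k, h, g] = ![l, k, h * g] := by
    funext i; fin_cases i <;> rfl
  have e3 : Fin.contractNth 3 (· * ·) ![l, k, h, g] = ![l, k, h] := by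
    funext i; fin_cases i <;> rfl
  have e4 : (fun i : Fin 3 => ![l, k, h, g] i.succ) = ![k, h, g] := by
    funext i; fin_cases i <;> rfl
  have s0 : (-1 : ℤ) ^ (3 - ((0 : Fin 4) : ℕ)) = -1 := rfl
  have s1 : (-1 : ℤ) ^ (3 - ((1 : Fin 4) : ℕ)) = 1 := rfl
  have s2 : (-1 : ℤ) ^ (3 - ((2 : Fin 4) : ℕ)) = -1 := rfl
  have s3 : (-1 : ℤ) ^ (3 - ((3 : Fin 4) : ℕ)) = 1 := rfl
  have s4 : (-1 : ℤ) ^ 4 = 1 := rfl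
  change (∑ j : Fin 4, (-1 : ℤ) ^ (3 - (j : ℕ)) • c (Fin.contractNth j (· * ·) ![l, k, h, g]))
    + (-1 : ℤ) ^ 4 • (l • c (fun i : Fin 3 => ![l, k, h, g] i.succ)) = _
  rw [Fin.sum_univ_four, e0, e1, e2, e3, e4, s0, s1, s2, s3, s4]
  simp only [neg_smul, one_smul]
  abel

theorem cptCocycles_pointed (z : cptCocycles G M 3) (k h g : G) (H : k = 1 ∨ h = 1 ∨ g = 1) :
    z.1 ![k, h, g] = 0 := by
  refine z.2.1 _ ?_
  rcases H with H | H | H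
  · exact ⟨0, H⟩
  · exact ⟨1, H⟩
  · exact ⟨2, H⟩

theorem cptCocycles_cocycle (z : cptCocycles G M 3) (l k h g : G) :
    z.1 ![l, k, h] - z.1 ![l, k, h * g] + z.1 ![l, k * h, g] - z.1 ![l * k, h, g]
      + l • z.1 ![k, h, g] = 0 := by
  rw [← cochainDifferential_three]
  exact congrFun z.2.2 _

end Cocycle

/-! ### Crossed modules and crossed module extensions -/

/-- A crossed module (with group part and module part in the universe `Type u`). -/
structure CrossedModule : Type (u + 1) where
  /-- The group part. -/
  GrpPart : Type u
  /-- The module part. -/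
  ModPart : Type u
  [grpGroup : Group GrpPart]
  [modGroup : Group ModPart]
  [action : MulDistribMulAction GrpPart ModPart]
  /-- The structure morphism. -/
  str : ModPart →* GrpPart
  equivariance : ∀ (g : GrpPart) (m : ModPart), str (g • m) = g * str m * g⁻¹
  peiffer : ∀ n m : ModPart, str n • m = n * m * n⁻¹

attribute [instance] CrossedModule.grpGroup CrossedModule.modGroup CrossedModule.action

/-- A morphism of crossed modules. -/
structure CrossedModule.Hom (V W : CrossedModule.{u}) : Type u where
  /-- The group part of the morphism. -/
  onGrp : V.GrpPart →* W.GrpPart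
  /-- The module part of the morphism. -/
  onMod : V.ModPart →* W.ModPart
  str_comm : ∀ m, W.str (onMod m) = onGrp (V.str m)
  map_action : ∀ (g : V.GrpPart) (m : V.ModPart), onMod (g • m) = onGrp g • onMod m

section Extensions

variable (G M : Type u) [Group G] [AddCommGroup M] [DistribMulAction G M]

/-- A crossed module extension of `G` with `M`. -/
structure CrossedModuleExtension : Type (u + 1) extends CrossedModule.{u} where
  /-- The canonical monomorphism. -/
  ι : Multiplicative M →* ModPart
  /-- The canonical epimorphism. -/
  π : GrpPart →* G
  ι_injective : Function.Injective ι
  exact_mod : ι.range = str.ker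
  exact_grp : str.range = π.ker
  π_surjective : Function.Surjective π
  action_ι : ∀ (e : GrpPart) (m : M),
    e • ι (Multiplicative.ofAdd m) = ι (Multiplicative.ofAdd (π e • m))

variable {G M}

/-- An extension equivalence: a morphism of the underlying crossed modules that is compatible
with the canonical monomorphisms and the canonical epimorphisms. -/
structure ExtensionEquivalence (E E' : CrossedModuleExtension G M) : Type u
    extends CrossedModule.Hom E.toCrossedModule E'.toCrossedModule where
  comp_ι : ∀ m, onMod (E.ι m) = E'.ι m
  π_comp : ∀ e, E'.π (onGrp e) = E.π e

variable (G M)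

/-- The equivalence relation generated by the existence of an extension equivalence. -/
def extensionSetoid : Setoid (CrossedModuleExtension G M) :=
  Relation.EqvGen.setoid fun E E' => Nonempty (ExtensionEquivalence E E')

/-- The set `Ext²(G, M)` of crossed module extension classes. -/
def ExtensionClasses : Type (u + 1) := Quotient (extensionSetoid G M)

variable {G M}

/-- Two crossed module extensions are extension equivalent. -/
def ExtensionEquivalent (E E' : CrossedModuleExtension G M) : Prop := (extensionSetoid G M) E E'

/-- The class of a crossed module extension. -/
def extensionClassOf (E : CrossedModuleExtension G M) : ExtensionClasses G M :=
  Quotient.mk (extensionSetoid G M) E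

end Extensions

/-! ### The free group on the pointed set `G` -/

section Free

variable (G : Type u) [Group G]

/-- The free group on the underlying pointed set of `G`, that is, on the set `G \ {1}`. -/
abbrev PtFreeGroup : Type u := FreeGroup {g : G // g ≠ 1}

/-- The extension of `id : G → G` to a homomorphism on the free group on `G`. -/
def ptProj : PtFreeGroup G →* G := FreeGroup.lift Subtype.val

variable {G}

open Classical in
/-- The basis of the free group on the pointed set `G`; it is pointed by construction. -/
noncomputable def ptBasis (g : G) : PtFreeGroup G := if h : g = 1 then 1 else FreeGroup.of ⟨g, h⟩

@[simp] theorem ptBasis_one : ptBasis (1 : G) = 1 := by simp [ptBasis]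

theorem ptBasis_coe (g : {g : G // g ≠ 1}) : ptBasis (g : G) = FreeGroup.of g := by
  simp [ptBasis, g.2]

@[simp] theorem ptProj_ptBasis (g : G) : ptProj G (ptBasis g) = g := by
  by_cases h : g = 1
  · simp [h]
  · simp [ptBasis, h, ptProj]

/-- The non-abelian `2`-cocycle `(h, g) ↦ (h s⁰) (g s⁰) ((h g) s⁰)⁻¹` of the free group with
respect to its basis `s⁰`. -/
noncomputable def freeCocycle (h g : G) : (ptProj G).ker :=
  ⟨ptBasis h * ptBasis g * (ptBasis (h * g))⁻¹, by simp [MonoidHom.mem_ker]⟩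

theorem coe_freeCocycle (h g : G) :
    (freeCocycle h g : PtFreeGroup G) = ptBasis h * ptBasis g * (ptBasis (h * g))⁻¹ := rfl

theorem closure_freeCocycle :
    Subgroup.closure (Set.range fun p : G × G => freeCocycle p.1 p.2) = ⊤ := by
  set L := Subgroup.closure (Set.range fun p : G × G => freeCocycle p.1 p.2) with hL
  have gen : ∀ h g : G, freeCocycle h g ∈ L := fun h g =>
    Subgroup.subset_closure ⟨(h, g), rfl⟩
  have key : ∀ w : PtFreeGroup G, ∀ x : G,
      ∃ r ∈ L, (r : PtFreeGroup G) = ptBasis x * w * (ptBasis (x * ptProj G w))⁻¹ := by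
    intro w
    induction w using FreeGroup.induction_on with
    | C1 => intro x; exact ⟨1, L.one_mem, by simp⟩
    | of g =>
      intro x
      refine ⟨freeCocycle x g, gen _ _, ?_⟩
      rw [coe_freeCocycle, ← ptBasis_coe, ptProj_ptBasis]
    | inv_of g _ =>
      intro x
      refine ⟨(freeCocycle (x * (g : G)⁻¹) g)⁻¹, L.inv_mem (gen _ _), ?_⟩
      rw [Subgroup.coe_inv, coe_freeCocycle, ← ptBasis_coe, map_inv, ptProj_ptBasis]
      simp [mul_assoc]
    | mul v w hv hw =>
      intro x
      obtain ⟨r, hr, hr'⟩ := hv x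
      obtain ⟨t, ht, ht'⟩ := hw (x * ptProj G v)
      refine ⟨r * t, L.mul_mem hr ht, ?_⟩
      rw [Subgroup.coe_mul, hr', ht', map_mul]
      simp [mul_assoc]
  rw [eq_top_iff]
  rintro w -
  obtain ⟨r, hr, hr'⟩ := key w 1
  have hw : ptProj G (w : PtFreeGroup G) = 1 := w.2
  have : r = w := Subtype.ext (by simp [hr', hw])
  exact this ▸ hr

theorem hom_ext_freeCocycle {A : Type*} [Group A] {φ ψ : (ptProj G).ker →* A}
    (H : ∀ h g, φ (freeCocycle h g) = ψ (freeCocycle h g)) : φ = ψ :=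
  MonoidHom.eq_of_eqOn_dense closure_freeCocycle (by rintro _ ⟨p, rfl⟩; exact H _ _)

theorem conj_freeCocycle (k h g : G) :
    MulAut.conjNormal (ptBasis k) (freeCocycle h g)
      = freeCocycle k h * freeCocycle (k * h) g * (freeCocycle k (h * g))⁻¹ := by
  apply Subtype.ext
  simp [coe_freeCocycle, mul_assoc]

variable (G) in
/-- Right translation of the argument, as an action of `G` on the functions on `G`. -/
def translationAction (A : Type*) [CommGroup A] : G →* MulAut (G → A) where
  toFun g :=
    { toFun := fun b x => b (x * g)
      invFun := fun b x => b (x * g⁻¹)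
      left_inv := fun b => by funext x; simp
      right_inv := fun b => by funext x; simp
      map_mul' := fun _ _ => rfl }
  map_one' := by ext b x; simp
  map_mul' g h := by ext b x; simp [mul_assoc]

/-- Rewriting of words: the first component `b` of the image of `w` satisfies
`b x = f (x, g)` for `w = g s⁰`, and `b x = b' x * b'' (x (w' π))` for `w = w' w''`. -/
def rewriteHom {A : Type*} [CommGroup A] (f : G → G → A) :
    PtFreeGroup G →* (G → A) ⋊[translationAction G A] G :=
  FreeGroup.lift fun g => ⟨fun x => f x g, g⟩

theorem rewriteHom_right {A : Type*} [CommGroup A] (f : G → G → A) (w : PtFreeGroup G) :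
    (rewriteHom f w).right = ptProj G w := by
  have : SemidirectProduct.rightHom.comp (rewriteHom f) = ptProj G := by
    ext g
    simp [rewriteHom, ptProj]
  exact DFunLike.congr_fun this w

theorem rewriteHom_ptBasis {A : Type*} [CommGroup A] (f : G → G → A) (hf : ∀ x, f x 1 = 1)
    (g x : G) : (rewriteHom f (ptBasis g)).left x = f x g := by
  by_cases h : g = 1
  · simp [h, hf]
  · simp [ptBasis, h, rewriteHom]

theorem rewriteHom_mul_left {A : Type*} [CommGroup A] (f : G → G → A) (v w : PtFreeGroup G)
    (x : G) : (rewriteHom f (v * w)).left x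
      = (rewriteHom f v).left x * (rewriteHom f w).left (x * ptProj G v) := by
  rw [map_mul, SemidirectProduct.mul_left, rewriteHom_right]
  rfl

/-- The homomorphism from the kernel of the projection of the free group on `G` to a commutative
group that sends the free generator `freeCocycle h g` to `f h g`, for componentwise pointed `f`
(see `kerLift_freeCocycle`). -/
def kerLift {A : Type*} [CommGroup A] (f : G → G → A) : (ptProj G).ker →* A where
  toFun r := (rewriteHom f r).left 1
  map_one' := by simp
  map_mul' r s := by
    have hr : ptProj G (r : PtFreeGroup G) = 1 := r.2
    rw [Subgroup.coe_mul, rewriteHom_mul_left, hr, mul_one]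

theorem kerLift_freeCocycle {A : Type*} [CommGroup A] (f : G → G → A) (hf : ∀ x, f x 1 = 1)
    (hf' : ∀ x, f 1 x = 1) (h g : G) : kerLift f (freeCocycle h g) = f h g := by
  have H : rewriteHom f (freeCocycle h g * ptBasis (h * g))
      = rewriteHom f (ptBasis h * ptBasis g) := by simp [coe_freeCocycle]
  have H' := congrFun (congrArg SemidirectProduct.left H) 1
  have hr : ptProj G (freeCocycle h g : PtFreeGroup G) = 1 := (freeCocycle h g).2
  rw [rewriteHom_mul_left, rewriteHom_mul_left, hr, rewriteHom_ptBasis f hf,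
    rewriteHom_ptBasis f hf, rewriteHom_ptBasis f hf, ptProj_ptBasis, mul_one, hf', hf', one_mul,
    mul_one, one_mul] at H'
  exact H'

end Free

/-! ### The standard extension -/

section Standard

variable {G M : Type u} [Group G] [AddCommGroup M] [DistribMulAction G M]

variable (G M) in
/-- The module part `M × Ker π` of the standard extension. -/
abbrev StdModPart : Type u := Multiplicative M × (ptProj G).ker

/-- The homomorphism `Ker π → M` with `freeCocycle h g ↦ - z (k, h, g)`. -/
def stdTwist (z : cptCocycles G M 3) (k : G) : (ptProj G).ker →* Multiplicative M :=
  kerLift fun h g => Multiplicative.ofAdd (-z.1 ![k, h, g])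

theorem stdTwist_freeCocycle (z : cptCocycles G M 3) (k h g : G) :
    stdTwist z k (freeCocycle h g) = Multiplicative.ofAdd (-z.1 ![k, h, g]) := by
  refine kerLift_freeCocycle _ ?_ ?_ h g
  · intro x; rw [cptCocycles_pointed z _ _ _ (by simp)]; simp
  · intro x; rw [cptCocycles_pointed z _ _ _ (by simp)]; simp

/-- The `G`-action on `M`, written multiplicatively. -/
def modAut : G →* MulAut (Multiplicative M) where
  toFun g := AddEquiv.toMultiplicative (DistribMulAction.toAddEquiv M g)
  map_one' := by ext m; exact one_smul G (Multiplicative.toAdd m)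
  map_mul' g h := by ext m; exact mul_smul g h (Multiplicative.toAdd m)

theorem modAut_apply (g : G) (m : Multiplicative M) :
    modAut g m = Multiplicative.ofAdd (g • Multiplicative.toAdd m) := rfl

/-- The automorphism of `M × Ker π` by which the basis element `k s⁰` acts: it sends `(m, 1)` to
`(k m, 1)`, and `(0, r)` for the free generator `r = freeCocycle h g` to
`(- z (k, h, g), (k s⁰) r (k s⁰)⁻¹)`. -/
noncomputable def stdAut (z : cptCocycles G M 3) (k : G) : MulAut (StdModPart G M) where
  toFun x := (modAut k x.1 * stdTwist z k x.2, MulAut.conjNormal (ptBasis k) x.2)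
  invFun x :=
    ((modAut k).symm (x.1 * (stdTwist z k ((MulAut.conjNormal (ptBasis k)).symm x.2))⁻¹),
      (MulAut.conjNormal (ptBasis k)).symm x.2)
  left_inv x := by
    refine Prod.ext ?_ ?_
    · simp only [MulEquiv.symm_apply_apply, mul_inv_cancel_right]
    · simp only [MulEquiv.symm_apply_apply]
  right_inv x := by
    refine Prod.ext ?_ ?_
    · simp only [MulEquiv.apply_symm_apply, inv_mul_cancel_right]
    · simp only [MulEquiv.apply_symm_apply]
  map_mul' x y := by
    refine Prod.ext ?_ ?_
    · simp only [Prod.fst_mul, Prod.snd_mul, map_mul]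
      exact mul_mul_mul_comm _ _ _ _
    · simp only [Prod.snd_mul, map_mul]

theorem stdAut_apply (z : cptCocycles G M 3) (k : G) (x : StdModPart G M) :
    stdAut z k x = (modAut k x.1 * stdTwist z k x.2, MulAut.conjNormal (ptBasis k) x.2) := rfl

theorem stdTwist_one (z : cptCocycles G M 3) : stdTwist z 1 = 1 := by
  apply hom_ext_freeCocycle
  intro h g
  rw [stdTwist_freeCocycle, cptCocycles_pointed z _ _ _ (by simp)]
  simp

theorem stdAut_one (z : cptCocycles G M 3) : stdAut z 1 = 1 := by
  apply MulEquiv.ext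
  intro x
  rw [stdAut_apply, stdTwist_one]
  simp

/-- The action of the free group on `M × Ker π`. -/
noncomputable def stdAction (z : cptCocycles G M 3) : PtFreeGroup G →* MulAut (StdModPart G M) :=
  FreeGroup.lift fun g => stdAut z g

theorem stdAction_ptBasis (z : cptCocycles G M 3) (k : G) :
    stdAction z (ptBasis k) = stdAut z k := by
  by_cases h : k = 1
  · simp [h, stdAut_one]
  · simp [ptBasis, h, stdAction]

theorem stdAction_snd (z : cptCocycles G M 3) (w : PtFreeGroup G) (x : StdModPart G M) :
    (stdAction z w x).2 = MulAut.conjNormal w x.2 := by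
  induction w using FreeGroup.induction_on generalizing x with
  | C1 => simp
  | of g => rw [← ptBasis_coe, stdAction_ptBasis, stdAut_apply]
  | inv_of g ih =>
    have h := ih ((stdAction z (FreeGroup.of g))⁻¹ x)
    rw [MulAut.apply_inv_self] at h
    rw [map_inv, map_inv, h, MulAut.inv_apply_self]
  | mul v w hv hw => rw [map_mul, map_mul, MulAut.mul_apply, MulAut.mul_apply, hv, hw]

theorem stdAction_inl (z : cptCocycles G M 3) (w : PtFreeGroup G) (m : Multiplicative M) :
    stdAction z w (m, 1) = (modAut (ptProj G w) m, 1) := by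
  induction w using FreeGroup.induction_on generalizing m with
  | C1 => simp
  | of g => rw [← ptBasis_coe, stdAction_ptBasis, stdAut_apply, ptProj_ptBasis]; simp
  | inv_of g ih =>
    rw [map_inv, map_inv, map_inv, MulAut.inv_apply, MulEquiv.symm_apply_eq, ih,
      MulAut.apply_inv_self]
  | mul v w hv hw => rw [map_mul, map_mul, map_mul, MulAut.mul_apply, MulAut.mul_apply, hw, hv]

theorem stdTwist_mul (z : cptCocycles G M 3) (l k : G) (r : (ptProj G).ker) :
    modAut l (stdTwist z k r) * stdTwist z l (MulAut.conjNormal (ptBasis k) r)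
      = stdTwist z (l * k) r := by
  have H : ((modAut l).toMonoidHom.comp (stdTwist z k))
      * ((stdTwist z l).comp (MulAut.conjNormal (ptBasis k)).toMonoidHom)
      = stdTwist z (l * k) := by
    apply hom_ext_freeCocycle
    intro h g
    simp only [MonoidHom.mul_apply, MonoidHom.comp_apply, MulEquiv.coe_toMonoidHom,
      conj_freeCocycle, map_mul, map_inv, stdTwist_freeCocycle, modAut_apply, toAdd_ofAdd,
      ← ofAdd_add, ← ofAdd_neg]
    congr 1
    have := cptCocycles_cocycle z l k h g
    rw [smul_neg]
    rw [← sub_eq_zero, ← neg_eq_zero, ← this]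
    abel
  exact DFunLike.congr_fun H r

variable (G M) in
/-- The conjugation action of the free group on the second component of `M × Ker π`. -/
noncomputable def conjSnd : PtFreeGroup G →* MulAut (StdModPart G M) where
  toFun w := MulEquiv.prodCongr (MulEquiv.refl _) (MulAut.conjNormal w)
  map_one' := by apply MulEquiv.ext; intro x; rw [map_one]; rfl
  map_mul' v w := by apply MulEquiv.ext; intro x; rw [map_mul]; rfl

theorem stdAction_freeCocycle (z : cptCocycles G M 3) (l k : G) :
    stdAction z (freeCocycle l k : PtFreeGroup G) = conjSnd G M (freeCocycle l k) := by
  rw [coe_freeCocycle, map_mul, map_mul, map_inv, mul_inv_eq_iff_eq_mul]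
  simp only [stdAction_ptBasis]
  apply MulEquiv.ext
  intro x
  rw [MulAut.mul_apply, MulAut.mul_apply, stdAut_apply, stdAut_apply, stdAut_apply]
  refine Prod.ext ?_ ?_
  · change modAut l (modAut k x.1 * stdTwist z k x.2) * _ = modAut (l * k) x.1 * _
    rw [map_mul, mul_assoc, stdTwist_mul, map_mul, MulAut.mul_apply]
  · change _ = MulAut.conjNormal (ptBasis l * ptBasis k * (ptBasis (l * k))⁻¹)
      (MulAut.conjNormal (ptBasis (l * k)) x.2)
    simp

theorem stdAction_ker (z : cptCocycles G M 3) (r : (ptProj G).ker) (x : StdModPart G M) :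
    stdAction z (r : PtFreeGroup G) x = (x.1, MulAut.conjNormal (r : PtFreeGroup G) x.2) := by
  have H : (stdAction z).comp (ptProj G).ker.subtype
      = (conjSnd G M).comp (ptProj G).ker.subtype := by
    apply hom_ext_freeCocycle
    intro h g
    exact stdAction_freeCocycle z h g
  exact DFunLike.congr_fun (DFunLike.congr_fun H r) x

/-- The standard extension of `G` with `M` with respect to a componentwise pointed `3`-cocycle
`z`: the group part is the free group on the pointed set `G`, the module part is `M × Ker π`, the
structure morphism is the projection to `Ker π` followed by the inclusion, and the action is
determined by `stdAction_ptBasis`, `stdAut_apply` and `stdTwist_freeCocycle`. -/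
noncomputable def standardExtension (z : cptCocycles G M 3) : CrossedModuleExtension G M where
  GrpPart := PtFreeGroup G
  ModPart := StdModPart G M
  action := MulDistribMulAction.compHom (StdModPart G M) (stdAction z)
  str := (ptProj G).ker.subtype.comp (MonoidHom.snd _ _)
  equivariance w x := by
    change ((stdAction z w x).2 : PtFreeGroup G) = _
    rw [stdAction_snd, MulAut.conjNormal_apply]
    rfl
  peiffer x y := by
    change stdAction z (x.2 : PtFreeGroup G) y = _
    rw [stdAction_ker]
    refine Prod.ext ?_ (Subtype.ext ?_)
    · simp
    · simp [MulAut.conjNormal_apply]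
  ι := MonoidHom.inl _ _
  π := ptProj G
  ι_injective m n h := congrArg Prod.fst h
  exact_mod := by
    ext x
    constructor
    · rintro ⟨m, rfl⟩
      simp [MonoidHom.mem_ker]
    · intro h
      have h' : x.2 = 1 := Subtype.ext h
      exact ⟨x.1, Prod.ext rfl h'.symm⟩
  exact_grp := by
    ext w
    constructor
    · rintro ⟨x, rfl⟩
      exact x.2.2
    · intro h
      exact ⟨(1, ⟨w, h⟩), rfl⟩
  π_surjective g := ⟨ptBasis g, ptProj_ptBasis g⟩
  action_ι w m := stdAction_inl z w _

end Standard

/-! ### Normalization of 2-cochains -/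

section Normalization

variable {G M : Type*} [Group G] [AddCommGroup M] [DistribMulAction G M]

/-! The point is that a 2-cochain `c` with `∂c = z - z'` yields a shear `(m, r) ↦ (m + φ r, r)` of
`M × Ker π`, where `φ : Ker π → M` is the homomorphism with `φ [h, g] = c (h, g)`. Together with the
identity of the free group this is an extension equivalence.

Since `[h, 1] = [1, g] = 1`, such a `φ` exists only if `c` is componentwise pointed. Equality of
classes merely provides some cochain with pointed differential, so
`exists_cptCochain_differential_eq` first corrects it by a coboundary.

Equivariance of the shear is a statement about homomorphisms out of the free group, so it suffices
to check it for the action of each `s(k)`. There it reduces to an identity of homomorphisms on `Ker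
π`, hence to the generators `[h, g]`. Writing the conjugate of `[h, g]` by `s(k)` as `[k, h] [kh, g]
[k, hg]⁻¹` turns this identity into `∂c = z - z'` at `(k, h, g)`; this is
`stdTwist_mul_cochainLift`. -/

/-- A `2`-cochain with componentwise pointed differential has the same differential as some
componentwise pointed `2`-cochain. -/
theorem exists_cptCochain_differential_eq (c : GroupCochain G M 2)
    (hc : cochainDifferential G M 2 c ∈ cptCochains G M 3) :
    ∃ d ∈ cptCochains G M 2, cochainDifferential G M 2 d = cochainDifferential G M 2 c := by
  -- Pointedness of `∂c` at `(1, 1, g)` and at `(g, 1, 1)` determines `c` on all pairs with an entry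
  -- `1` from the single value `c (1, 1)`.
  have left (g : G) : c ![1, g] = c ![1, 1] := by
    have h := hc ![1, 1, g] ⟨0, rfl⟩
    rw [cochainDifferential_two] at h
    exact (sub_eq_zero.mp (by simpa using h)).symm
  have right (g : G) : c ![g, 1] = g • c ![1, 1] := by
    have h := hc ![g, 1, 1] ⟨1, rfl⟩
    rw [cochainDifferential_two] at h
    simpa [sub_eq_zero] using h
  -- The subtracted cochain `(h, g) ↦ h c (1, 1)` is the coboundary of the constant 1-cochain `c (1,
  -- 1)`, so the differential does not change.
  refine ⟨fun x => c x - x 0 • c ![1, 1], ?_, ?_⟩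
  · rintro x ⟨i, hi⟩
    obtain ⟨h, g, rfl⟩ : ∃ h g, x = ![h, g] := ⟨x 0, x 1, by funext j; fin_cases j <;> rfl⟩
    fin_cases i
    · obtain rfl : h = 1 := hi
      simp [left g]
    · obtain rfl : g = 1 := hi
      simp [right h]
  · funext x
    obtain ⟨k, h, g, rfl⟩ : ∃ k h g, x = ![k, h, g] :=
      ⟨x 0, x 1, x 2, by funext j; fin_cases j <;> rfl⟩
    rw [cochainDifferential_two, cochainDifferential_two]
    simp only [Matrix.cons_val_zero, smul_sub, mul_smul]
    abel

/-- Cohomologous componentwise pointed `3`-cocycles differ by the differential of a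
componentwise pointed `2`-cochain. -/
theorem exists_cptCochain_of_cptClass_eq {z z' : cptCocycles G M 3}
    (H : cptClass z = cptClass z') :
    ∃ c ∈ cptCochains G M 2, cochainDifferential G M 2 c = z.1 - z'.1 := by
  -- Equality of cosets of `a` and `b` unfolds to `-a + b`; reading `H` backwards gives the sign `z
  -- - z'`.
  have h : -z'.1 + z.1 ∈ cptCoboundaries G M 3 := by
    simpa [AddSubgroup.mem_addSubgroupOf] using QuotientAddGroup.eq.mp (show
      (QuotientAddGroup.mk z' : CptCohomology G M 3) = QuotientAddGroup.mk z from H.symm)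
  rw [neg_add_eq_sub] at h
  -- Only the difference is known to be pointed; its preimage `c` is an arbitrary 2-cochain.
  obtain ⟨hpt, c, hc⟩ := h
  rw [← hc] at hpt ⊢
  exact exists_cptCochain_differential_eq c hpt

end Normalization

/-! ### Shears as extension equivalences -/

section Shear

variable {G M : Type u} [Group G] [AddCommGroup M]

/-- The automorphism `(m, r) ↦ (m + φ r, r)` of `M × Ker π`. -/
def shearAut (φ : (ptProj G).ker →* Multiplicative M) : MulAut (StdModPart G M) where
  toFun x := (x.1 * φ x.2, x.2)
  invFun x := (x.1 * (φ x.2)⁻¹, x.2)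
  left_inv x := by simp
  right_inv x := by simp
  map_mul' x y := by
    refine Prod.ext ?_ rfl
    simp only [Prod.fst_mul, Prod.snd_mul, map_mul]
    exact mul_mul_mul_comm _ _ _ _

theorem shearAut_apply (φ : (ptProj G).ker →* Multiplicative M) (x : StdModPart G M) :
    shearAut φ x = (x.1 * φ x.2, x.2) := rfl

/-- The homomorphism `Ker π → M` with `freeCocycle h g ↦ c (h, g)`. -/
def cochainLift (c : GroupCochain G M 2) : (ptProj G).ker →* Multiplicative M :=
  kerLift fun h g => Multiplicative.ofAdd (c ![h, g])

theorem cochainLift_freeCocycle {c : GroupCochain G M 2} (hc : c ∈ cptCochains G M 2) (h g : G) :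
    cochainLift c (freeCocycle h g) = Multiplicative.ofAdd (c ![h, g]) := by
  refine kerLift_freeCocycle _ (fun x => ?_) (fun x => ?_) h g
  · rw [hc _ ⟨1, rfl⟩, ofAdd_zero]
  · rw [hc _ ⟨0, rfl⟩, ofAdd_zero]

variable [DistribMulAction G M] {z z' : cptCocycles G M 3} {c : GroupCochain G M 2}

/-- This is the first component of the equivariance of the shear under `s(k)`. On a generator `[h,
g]` it is the equation `∂c = z - z'` at `(k, h, g)`. -/
theorem stdTwist_mul_cochainLift (hc : c ∈ cptCochains G M 2)
    (H : cochainDifferential G M 2 c = z.1 - z'.1) (k : G) (r : (ptProj G).ker) :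
    stdTwist z k r * cochainLift c (MulAut.conjNormal (ptBasis k) r)
      = modAut k (cochainLift c r) * stdTwist z' k r := by
  have key : stdTwist z k * (cochainLift c).comp (MulAut.conjNormal (ptBasis k)).toMonoidHom
      = (modAut k).toMonoidHom.comp (cochainLift c) * stdTwist z' k := by
    apply hom_ext_freeCocycle
    intro h g
    have h' := congrFun H ![k, h, g]
    rw [cochainDifferential_two, Pi.sub_apply, ← sub_eq_zero] at h'
    simp only [MonoidHom.mul_apply, MonoidHom.comp_apply, MulEquiv.coe_toMonoidHom,
      conj_freeCocycle, map_mul, map_inv, stdTwist_freeCocycle, cochainLift_freeCocycle hc,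
      modAut_apply, toAdd_ofAdd, ← ofAdd_add, ← ofAdd_neg]
    congr 1
    rw [← sub_eq_zero, ← h']
    abel
  exact DFunLike.congr_fun key r

/-- Conjugating the action for `z` by the shear again gives a homomorphism from the free group to
the automorphism group, so it is compared with the action for `z'` on the basis only. -/
theorem shearAut_stdAction (hc : c ∈ cptCochains G M 2)
    (H : cochainDifferential G M 2 c = z.1 - z'.1) (w : PtFreeGroup G) (x : StdModPart G M) :
    shearAut (cochainLift c) (stdAction z w x)
      = stdAction z' w (shearAut (cochainLift c) x) := by
  have key : (MulAut.conj (shearAut (cochainLift c))).toMonoidHom.comp (stdAction z)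
      = stdAction z' := by
    refine FreeGroup.ext_hom _ _ fun k => ?_
    rw [← ptBasis_coe, MonoidHom.comp_apply, MulEquiv.coe_toMonoidHom, MulAut.conj_apply,
      stdAction_ptBasis, stdAction_ptBasis, mul_inv_eq_iff_eq_mul]
    refine MulEquiv.ext fun y => Prod.ext ?_ rfl
    simp only [MulAut.mul_apply, stdAut_apply, shearAut_apply, map_mul, mul_assoc,
      stdTwist_mul_cochainLift hc H]
  -- Evaluating at the sheared element cancels the inverse shear in the conjugate.
  have h := DFunLike.congr_fun (DFunLike.congr_fun key w) (shearAut (cochainLift c) x)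
  simpa [MulAut.conj_apply] using h

/-- The extension equivalence of standard extensions `(m, r) ↦ (m + c r, r)` given by a
componentwise pointed `2`-cochain whose differential is the difference of the cocycles. -/
noncomputable def standardExtensionEquivalence (hc : c ∈ cptCochains G M 2)
    (H : cochainDifferential G M 2 c = z.1 - z'.1) :
    ExtensionEquivalence (standardExtension z) (standardExtension z') where
  onGrp := MonoidHom.id (PtFreeGroup G)
  onMod := (shearAut (cochainLift c)).toMonoidHom
  str_comm _ := rfl
  map_action w x := shearAut_stdAction hc H w x
  comp_ι m := Prod.ext (by
    change m * cochainLift c 1 = m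
    rw [map_one, mul_one]) rfl
  π_comp _ := rfl

theorem extensionEquivalent_standardExtension (H : cptClass z = cptClass z') :
    ExtensionEquivalent (standardExtension z) (standardExtension z') := by
  obtain ⟨c, hc, hz⟩ := exists_cptCochain_of_cptClass_eq H
  -- A single extension equivalence suffices; no zigzag is needed.
  exact Relation.EqvGen.rel _ _ ⟨standardExtensionEquivalence hc hz⟩

end Shear

theorem mainTheorem7 (G M : Type u) [Group G] [AddCommGroup M] [DistribMulAction G M] :
    (∀ z z' : cptCocycles G M 3, cptClass z = cptClass z' →
      ExtensionEquivalent (standardExtension z) (standardExtension z')) ∧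
    ∃! cl : CptCohomology G M 3 → ExtensionClasses G M,
      ∀ z : cptCocycles G M 3, cl (cptClass z) = extensionClassOf (standardExtension z) := by
  have wd (z z' : cptCocycles G M 3) (H : cptClass z = cptClass z') :
      ExtensionEquivalent (standardExtension z) (standardExtension z') :=
    extensionEquivalent_standardExtension H
  -- The inner `Quotient.sound` turns the coset relation into equality of cohomology classes, as
  -- `wd` requires. Uniqueness holds because every class is represented by a cocycle.
  refine ⟨wd, fun x => Quotient.liftOn x (fun z => extensionClassOf (standardExtension z))
    fun z z' h => Quotient.sound (wd z z' (Quotient.sound h)), fun _ => rfl, fun cl hcl => ?_⟩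
  funext x
  obtain ⟨z, rfl⟩ := QuotientAddGroup.mk_surjective x
  exact hcl z
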